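/- Identify $\mathcal M_n(\mathbb C)\otimes\mathcal M_m(\mathbb C)$ with the algebra of operators on $\mathbb C^n\otimes\mathbb C^m$. The operator Schmidt rank $\Omega(X)$ of $X\in\mathcal M_n(\mathbb C)\otimes\mathcal M_m(\mathbb C)$ is the unique number $r\in\mathbb N$ such that $X=\sum_{i=1}^{r}A_i\otimes B_i$ for some non-zero, pairwise orthogonal $A_1,\dots,A_r\in\mathcal M_n(\mathbb C)$ and some non-zero, pairwise orthogonal $B_1,\dots,B_r\in\mathcal M_m(\mathbb C)$, where orthogonality is with respect to the Hilbert–Schmidt inner product $\langle A,B\rangle=\operatorname{tr}(A^*B)$. Theorem. Let $n,m$ be positive integers with $(n,m)\neq(2,2)$. Then for every $r\in\{1,2,\dots,\min(n,m)^2\}$ there exists a unitary operator $U$ on $\mathbb C^n\otimes\mathbb C^m$ with $\Omega(U)=r$. -/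

import Mathlib

open scoped Matrix Kronecker

/-- The Hilbert-Schmidt inner product `⟨A, B⟩ = tr (A* B)` on complex square matrices. -/
noncomputable def hilbertSchmidtInner {ι : Type*} [Fintype ι] (A B : Matrix ι ι ℂ) : ℂ :=
  (Aᴴ * B).trace

/-- `X = ∑ i, A i ⊗ B i` is an operator Schmidt decomposition with `r` terms: the `A i` are
nonzero and pairwise orthogonal for the Hilbert-Schmidt inner product, and so are the `B i`.
The algebra `M_n(ℂ) ⊗ M_m(ℂ)` is identified with the matrices indexed by pairs, through the
Kronecker product. -/
structure IsOperatorSchmidtDecomposition {ι κ : Type*} [Fintype ι] [Fintype κ]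
    (X : Matrix (ι × κ) (ι × κ) ℂ) (r : ℕ)
    (A : Fin r → Matrix ι ι ℂ) (B : Fin r → Matrix κ κ ℂ) : Prop where
  left_ne_zero : ∀ i, A i ≠ 0
  right_ne_zero : ∀ i, B i ≠ 0
  left_orthogonal : ∀ i j, i ≠ j → hilbertSchmidtInner (A i) (A j) = 0
  right_orthogonal : ∀ i j, i ≠ j → hilbertSchmidtInner (B i) (B j) = 0
  eq_sum : X = ∑ i, A i ⊗ₖ B i

/-- The operator Schmidt rank `Ω(X)`: the number of terms of an operator Schmidt decomposition
of `X`. This number exists and is unique, see `existsUnique_operatorSchmidtDecomposition` and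
`operatorSchmidtRank_eq_iff`. -/
noncomputable def operatorSchmidtRank {ι κ : Type*} [Fintype ι] [Fintype κ]
    (X : Matrix (ι × κ) (ι × κ) ℂ) : ℕ :=
  sInf {r : ℕ | ∃ (A : Fin r → Matrix ι ι ℂ) (B : Fin r → Matrix κ κ ℂ),
    IsOperatorSchmidtDecomposition X r A B}

theorem hilbertSchmidtInner_eq_sum {ι : Type*} [Fintype ι] (A B : Matrix ι ι ℂ) :
    hilbertSchmidtInner A B = ∑ p : ι × ι, star (A p.1 p.2) * B p.1 p.2 := by
  simp only [hilbertSchmidtInner, Matrix.trace, Matrix.diag_apply, Matrix.mul_apply,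
    Matrix.conjTranspose_apply]
  rw [Finset.sum_comm, Fintype.sum_prod_type]

open scoped ComplexOrder in
theorem hilbertSchmidtInner_self_ne_zero {ι : Type*} [Fintype ι] {A : Matrix ι ι ℂ}
    (hA : A ≠ 0) : hilbertSchmidtInner A A ≠ 0 := fun h =>
  hA (Matrix.trace_conjTranspose_mul_self_eq_zero_iff.mp h)

/-- The realignment of `X`, whose rows are the flattened blocks of `X`. -/
def realignment {ι κ : Type*} (X : Matrix (ι × κ) (ι × κ) ℂ) : Matrix (ι × ι) (κ × κ) ℂ :=
  Matrix.of fun p q => X (p.1, q.1) (p.2, q.2)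

theorem IsOperatorSchmidtDecomposition.eq_rank {ι κ : Type*} [Fintype ι] [Fintype κ]
    {X : Matrix (ι × κ) (ι × κ) ℂ} {r : ℕ}
    {A : Fin r → Matrix ι ι ℂ} {B : Fin r → Matrix κ κ ℂ}
    (h : IsOperatorSchmidtDecomposition X r A B) : r = (realignment X).rank := by
  classical
  set P : Matrix (ι × ι) (Fin r) ℂ := Matrix.of fun p s => A s p.1 p.2 with hP
  set Q : Matrix (κ × κ) (Fin r) ℂ := Matrix.of fun p s => B s p.1 p.2 with hQ
  have hR : realignment X = P * Qᵀ := by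
    ext p q
    rw [Matrix.mul_apply, realignment, Matrix.of_apply, h.eq_sum, Matrix.sum_apply]
    rfl
  have hPP : Pᴴ * P = Matrix.diagonal fun s => hilbertSchmidtInner (A s) (A s) := by
    ext s t
    have : (Pᴴ * P) s t = hilbertSchmidtInner (A s) (A t) := by
      rw [hilbertSchmidtInner_eq_sum, Matrix.mul_apply]; rfl
    rw [this]
    rcases eq_or_ne s t with rfl | hst
    · simp
    · rw [Matrix.diagonal_apply_ne _ hst, h.left_orthogonal s t hst]
  have hQQ : Qᴴ * Q = Matrix.diagonal fun s => hilbertSchmidtInner (B s) (B s) := by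
    ext s t
    have : (Qᴴ * Q) s t = hilbertSchmidtInner (B s) (B t) := by
      rw [hilbertSchmidtInner_eq_sum, Matrix.mul_apply]; rfl
    rw [this]
    rcases eq_or_ne s t with rfl | hst
    · simp
    · rw [Matrix.diagonal_apply_ne _ hst, h.right_orthogonal s t hst]
  have hQQ' : Qᵀ * Qᴴᵀ = Matrix.diagonal fun s => hilbertSchmidtInner (B s) (B s) := by
    rw [← Matrix.transpose_mul, hQQ, Matrix.diagonal_transpose]
  have key : Pᴴ * (realignment X) * Qᴴᵀ = Matrix.diagonal fun s =>
      hilbertSchmidtInner (A s) (A s) * hilbertSchmidtInner (B s) (B s) := by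
    rw [hR, ← Matrix.mul_assoc, Matrix.mul_assoc, hQQ', hPP, Matrix.diagonal_mul_diagonal]
  apply le_antisymm
  · have hr : (Matrix.diagonal fun s : Fin r =>
        hilbertSchmidtInner (A s) (A s) * hilbertSchmidtInner (B s) (B s)).rank = r := by
      rw [Matrix.rank_of_isUnit]
      · simp
      · rw [Matrix.isUnit_iff_isUnit_det, Matrix.det_diagonal, isUnit_iff_ne_zero]
        exact Finset.prod_ne_zero_iff.mpr fun s _ => mul_ne_zero
          (hilbertSchmidtInner_self_ne_zero (h.left_ne_zero s))
          (hilbertSchmidtInner_self_ne_zero (h.right_ne_zero s))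
    calc r = (Pᴴ * (realignment X) * Qᴴᵀ).rank := by rw [key, hr]
      _ ≤ (Pᴴ * (realignment X)).rank := Matrix.rank_mul_le_left _ _
      _ ≤ (realignment X).rank := Matrix.rank_mul_le_right _ _
  · calc (realignment X).rank = (P * Qᵀ).rank := by rw [hR]
      _ ≤ P.rank := Matrix.rank_mul_le_left _ _
      _ ≤ r := by simpa using Matrix.rank_le_card_width P

theorem exists_operatorSchmidtDecomposition {ι κ : Type*} [Fintype ι] [Fintype κ]
    (X : Matrix (ι × κ) (ι × κ) ℂ) :
    ∃ (r : ℕ) (A : Fin r → Matrix ι ι ℂ) (B : Fin r → Matrix κ κ ℂ),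
      IsOperatorSchmidtDecomposition X r A B := by
  classical
  set R := realignment X with hRdef
  have hH : (Rᴴ * R).IsHermitian := Matrix.isHermitian_conjTranspose_mul_self R
  set V : Matrix (κ × κ) (κ × κ) ℂ := hH.eigenvectorUnitary.1 with hV
  have hVV : Vᴴ * V = 1 := Unitary.coe_star_mul_self hH.eigenvectorUnitary
  have hVV' : V * Vᴴ = 1 := Unitary.coe_mul_star_self hH.eigenvectorUnitary
  set W := R * V with hW
  have hWW : Wᴴ * W = Matrix.diagonal ((RCLike.ofReal : ℝ → ℂ) ∘ hH.eigenvalues) := by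
    have hs := hH.spectral_theorem
    rw [Unitary.conjStarAlgAut_apply] at hs
    change Rᴴ * R = V * _ * Vᴴ at hs
    generalize Matrix.diagonal ((RCLike.ofReal : ℝ → ℂ) ∘ hH.eigenvalues) = D at hs ⊢
    calc Wᴴ * W = Vᴴ * (Rᴴ * R) * V := by
          rw [hW, Matrix.conjTranspose_mul]; simp only [Matrix.mul_assoc]
      _ = (Vᴴ * V) * D * (Vᴴ * V) := by
          rw [hs]; simp only [Matrix.mul_assoc]
      _ = _ := by rw [hVV, Matrix.one_mul, Matrix.mul_one]
  have hR : R = W * Vᴴ := by rw [hW, Matrix.mul_assoc, hVV', Matrix.mul_one]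
  let A : κ × κ → Matrix ι ι ℂ := fun s => Matrix.of fun i j => W (i, j) s
  let B : κ × κ → Matrix κ κ ℂ := fun s => Matrix.of fun k l => star (V (k, l) s)
  have hA : ∀ s t, s ≠ t → hilbertSchmidtInner (A s) (A t) = 0 := by
    intro s t hst
    have : hilbertSchmidtInner (A s) (A t) = (Wᴴ * W) s t := by
      rw [hilbertSchmidtInner_eq_sum, Matrix.mul_apply]; rfl
    rw [this, hWW, Matrix.diagonal_apply_ne _ hst]
  have hB : ∀ s t, hilbertSchmidtInner (B s) (B t) = (1 : Matrix (κ × κ) (κ × κ) ℂ) t s := by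
    intro s t
    rw [hilbertSchmidtInner_eq_sum, ← hVV, Matrix.mul_apply]
    refine Finset.sum_congr rfl fun p _ => ?_
    simp only [B, Matrix.of_apply, star_star, Matrix.conjTranspose_apply]
    exact mul_comm _ _
  have hX : X = ∑ s, A s ⊗ₖ B s := by
    ext ⟨i, k⟩ ⟨j, l⟩
    have := congrFun (congrFun hR (i, j)) (k, l)
    rw [Matrix.mul_apply] at this
    rw [Matrix.sum_apply]
    exact this
  let T := {s : κ × κ // A s ≠ 0}
  let e : Fin (Fintype.card T) ≃ T := (Fintype.equivFin T).symm
  have he : ∀ i j, i ≠ j → (e i).1 ≠ (e j).1 := fun i j hij h =>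
    hij (e.injective (Subtype.ext h))
  refine ⟨Fintype.card T, fun i => A (e i).1, fun i => B (e i).1, fun i => (e i).2, ?_, ?_, ?_, ?_⟩
  · intro i h0
    have := hB (e i).1 (e i).1
    rw [h0] at this
    simp [hilbertSchmidtInner] at this
  · exact fun i j hij => hA _ _ (he i j hij)
  · intro i j hij
    rw [hB, Matrix.one_apply_ne (he j i hij.symm)]
  · rw [e.sum_comp (fun s : T => A s.1 ⊗ₖ B s.1), hX]
    rw [← Finset.sum_subtype (Finset.univ.filter fun s => A s ≠ 0) (by simp)
      (fun s => A s ⊗ₖ B s)]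
    symm
    apply Finset.sum_filter_of_ne
    intro s _ hs h0
    exact hs (by rw [h0, Matrix.zero_kronecker])

theorem existsUnique_operatorSchmidtDecomposition {ι κ : Type*} [Fintype ι] [Fintype κ]
    (X : Matrix (ι × κ) (ι × κ) ℂ) :
    ∃! r : ℕ, ∃ (A : Fin r → Matrix ι ι ℂ) (B : Fin r → Matrix κ κ ℂ),
      IsOperatorSchmidtDecomposition X r A B := by
  obtain ⟨r, A, B, h⟩ := exists_operatorSchmidtDecomposition X
  refine ⟨r, ⟨A, B, h⟩, ?_⟩
  rintro s ⟨A', B', h'⟩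
  rw [h'.eq_rank, h.eq_rank]

theorem operatorSchmidtRank_eq_iff {ι κ : Type*} [Fintype ι] [Fintype κ]
    (X : Matrix (ι × κ) (ι × κ) ℂ) (r : ℕ) :
    operatorSchmidtRank X = r ↔
      ∃ (A : Fin r → Matrix ι ι ℂ) (B : Fin r → Matrix κ κ ℂ),
        IsOperatorSchmidtDecomposition X r A B := by
  have hex := existsUnique_operatorSchmidtDecomposition X
  have hmem := Nat.sInf_mem hex.exists
  constructor
  · rintro rfl
    exact hmem
  · exact fun h => hex.unique hmem h

/-! The operator Schmidt rank is the rank of the realignment, the dimension of the span of the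
blocks of `U`. Two constructions produce all ranks. Enlarging one factor by a dimension and adding a
unitary `W` as a new diagonal block raises the rank by one, unless it is already maximal: unitaries
span the matrix algebra, so some `W` avoids the old span (`IsUnitarySchmidtRank.extend`). On
`ℂ^(k+1) ⊗ ℂ^(k+1)`, mixing each `e i ⊗ e k` with its flip, with amplitudes `M` (unflipped) and `N`
(flipped), gives rank `M.rank` plus the number of nonzero entries of `N`
(`rank_realignment_partialFlip`). Arrow-shaped `M` yields the ranks from `k ^ 2` to `(k + 1) ^ 2`,
except `(k + 1) ^ 2 - 1` when `k ≤ 1`. Induction on the dimension covers the smaller ranks. The gap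
at rank 3 for two qubits does not propagate, since extension reaches `n ^ 2 - 1` from `n ^ 2 - 2`
and `n ^ 2` from itself. -/

theorem operatorSchmidtRank_eq_rank_realignment {ι κ : Type*} [Fintype ι] [Fintype κ]
    (X : Matrix (ι × κ) (ι × κ) ℂ) : operatorSchmidtRank X = (realignment X).rank := by
  obtain ⟨r, A, B, h⟩ := exists_operatorSchmidtDecomposition X
  rw [(operatorSchmidtRank_eq_iff X r).2 ⟨A, B, h⟩, h.eq_rank]

/-- Some unitary on `ℂ^ι ⊗ ℂ^κ` has operator Schmidt rank `r`, in terms of realignments. -/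
def IsUnitarySchmidtRank (ι κ : Type*) [Fintype ι] [Fintype κ] [DecidableEq ι] [DecidableEq κ]
    (r : ℕ) : Prop :=
  ∃ U ∈ Matrix.unitaryGroup (ι × κ) ℂ, (realignment U).rank = r

theorem Matrix.submatrix_mem_unitaryGroup {α β : Type*} [Fintype α] [Fintype β] [DecidableEq α]
    [DecidableEq β] {U : Matrix α α ℂ} (hU : U ∈ Matrix.unitaryGroup α ℂ) (e : β ≃ α) :
    U.submatrix e e ∈ Matrix.unitaryGroup β ℂ := by
  rw [Matrix.mem_unitaryGroup_iff] at hU ⊢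
  rw [Matrix.star_eq_conjTranspose, Matrix.conjTranspose_submatrix, Matrix.submatrix_mul_equiv,
    ← Matrix.star_eq_conjTranspose, hU, Matrix.submatrix_one_equiv]

/-! ### Reindexing, exchange of factors, and rank one -/

section transport

variable {ι κ ι' κ' : Type*} [Fintype ι] [Fintype κ] [DecidableEq ι] [DecidableEq κ]
  [Fintype ι'] [Fintype κ'] [DecidableEq ι'] [DecidableEq κ'] {r : ℕ}

theorem IsUnitarySchmidtRank.congr (h : IsUnitarySchmidtRank ι κ r) (e : ι' ≃ ι) (f : κ' ≃ κ) :
    IsUnitarySchmidtRank ι' κ' r := by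
  obtain ⟨U, hU, rfl⟩ := h
  exact ⟨_, Matrix.submatrix_mem_unitaryGroup hU (e.prodCongr f),
    Matrix.rank_submatrix (realignment U) (e.prodCongr e) (f.prodCongr f)⟩

theorem IsUnitarySchmidtRank.swap (h : IsUnitarySchmidtRank ι κ r) :
    IsUnitarySchmidtRank κ ι r := by
  obtain ⟨U, hU, rfl⟩ := h
  exact ⟨_, Matrix.submatrix_mem_unitaryGroup hU (Equiv.prodComm κ ι),
    Matrix.rank_transpose (realignment U)⟩

theorem isUnitarySchmidtRank_one [Nonempty ι] [Nonempty κ] : IsUnitarySchmidtRank ι κ 1 := by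
  refine ⟨1, one_mem _, ?_⟩
  have h : realignment (1 : Matrix (ι × κ) (ι × κ) ℂ) = Matrix.vecMulVec
      (fun p : ι × ι => if p.1 = p.2 then 1 else 0)
      (fun p : κ × κ => if p.1 = p.2 then 1 else 0) := by
    ext ⟨i, j⟩ ⟨k, l⟩
    by_cases hij : i = j <;> by_cases hkl : k = l <;>
      simp [realignment, Matrix.vecMulVec, hij, hkl]
  apply le_antisymm
  · rw [h]
    exact Matrix.rank_vecMulVec_le _ _
  · rw [Nat.one_le_iff_ne_zero, Matrix.rank_eq_finrank_span_cols, ne_eq,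
      Submodule.finrank_eq_zero, Submodule.span_eq_bot]
    intro h0
    have i := Classical.arbitrary ι
    have k := Classical.arbitrary κ
    have := congrFun (h0 _ ⟨(k, k), rfl⟩) (i, i)
    simp [realignment] at this

end transport

/-! ### Enlarging one tensor factor -/

section extension

variable {ι κ : Type*} [Fintype ι] [Fintype κ] [DecidableEq ι] [DecidableEq κ]

open scoped Matrix.Norms.L2Operator in
/-- The unitaries span the full matrix algebra, so a proper subspace misses one of them. -/
theorem Matrix.exists_unitary_notMem {p : Submodule ℂ (Matrix ι ι ℂ)} (hp : p ≠ ⊤) :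
    ∃ W ∈ Matrix.unitaryGroup ι ℂ, W ∉ p := by
  by_contra! h
  apply hp
  rw [eq_top_iff, ← CStarAlgebra.span_unitary (Matrix ι ι ℂ)]
  exact Submodule.span_le.2 h

/-- The operator `U ⊕ W` on `ℂ^ι ⊗ (ℂ^κ ⊕ ℂ)`. -/
def unitarySum (U : Matrix (ι × κ) (ι × κ) ℂ) (W : Matrix ι ι ℂ) :
    Matrix (ι × (κ ⊕ Unit)) (ι × (κ ⊕ Unit)) ℂ :=
  (Matrix.fromBlocks U 0 0 (W.submatrix Prod.fst (Prod.fst : ι × Unit → ι))).submatrix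
    (Equiv.prodSumDistrib ι κ Unit) (Equiv.prodSumDistrib ι κ Unit)

theorem unitarySum_mem {U : Matrix (ι × κ) (ι × κ) ℂ} {W : Matrix ι ι ℂ}
    (hU : U ∈ Matrix.unitaryGroup (ι × κ) ℂ) (hW : W ∈ Matrix.unitaryGroup ι ℂ) :
    unitarySum U W ∈ Matrix.unitaryGroup (ι × (κ ⊕ Unit)) ℂ := by
  refine Matrix.submatrix_mem_unitaryGroup ?_ _
  have hW' := Matrix.submatrix_mem_unitaryGroup hW (Equiv.prodPUnit ι)
  rw [Matrix.mem_unitaryGroup_iff, Matrix.star_eq_conjTranspose] at hU hW' ⊢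
  rw [Matrix.fromBlocks_conjTranspose, Matrix.fromBlocks_multiply]
  change Matrix.fromBlocks _ _ _ (_ + W.submatrix (Equiv.prodPUnit ι) (Equiv.prodPUnit ι) *
    (W.submatrix (Equiv.prodPUnit ι) (Equiv.prodPUnit ι))ᴴ) = 1
  rw [hU, hW']
  simp

/-- Columns of the realignment are flattened blocks; the only new nonzero block a direct sum can
bring is `W`. -/
theorem span_col_realignment_unitarySum {ι κ : Type*} (U : Matrix (ι × κ) (ι × κ) ℂ) (W : Matrix ι ι ℂ) :
    Submodule.span ℂ (Set.range (realignment (unitarySum U W)).col) =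
      Submodule.span ℂ (Set.range (realignment U).col) ⊔
        Submodule.span ℂ {fun p : ι × ι => W p.1 p.2} := by
  rw [← Submodule.span_union]
  apply le_antisymm
  · rw [Submodule.span_le]
    rintro _ ⟨⟨k | _, l | _⟩, rfl⟩
    · exact Submodule.subset_span (Or.inl ⟨(k, l), rfl⟩)
    · exact Submodule.zero_mem _
    · exact Submodule.zero_mem _
    · exact Submodule.subset_span (Or.inr rfl)
  · apply Submodule.span_mono
    rintro _ (⟨⟨k, l⟩, rfl⟩ | rfl)
    · exact ⟨(Sum.inl k, Sum.inl l), rfl⟩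
    · exact ⟨(Sum.inr (), Sum.inr ()), rfl⟩

theorem IsUnitarySchmidtRank.extend {r : ℕ} (h : IsUnitarySchmidtRank ι κ r) :
    IsUnitarySchmidtRank ι (κ ⊕ Unit) (min (r + 1) (Fintype.card ι ^ 2)) := by
  obtain ⟨U, hU, rfl⟩ := h
  set p := Submodule.span ℂ (Set.range (realignment U).col) with hp
  have hrank : (realignment U).rank = Module.finrank ℂ p := Matrix.rank_eq_finrank_span_cols _
  have hdim : Module.finrank ℂ (ι × ι → ℂ) = Fintype.card ι ^ 2 := by
    rw [Module.finrank_pi, Fintype.card_prod, sq]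
  have key : ∀ W, (realignment (unitarySum U W)).rank = Module.finrank ℂ
      (p ⊔ Submodule.span ℂ {fun q : ι × ι => W q.1 q.2} : Submodule ℂ (ι × ι → ℂ)) := fun W => by
    rw [Matrix.rank_eq_finrank_span_cols, span_col_realignment_unitarySum]
  by_cases htop : p = ⊤
  -- The blocks already span everything, so any unitary serves and the cap is attained.
  · refine ⟨unitarySum U 1, unitarySum_mem hU (one_mem _), ?_⟩
    rw [key, hrank, htop, top_sup_eq, finrank_top, hdim]
    simp
  · obtain ⟨W, hW, hWp⟩ : ∃ W ∈ Matrix.unitaryGroup ι ℂ,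
        (fun q : ι × ι => W q.1 q.2) ∉ p := by
      let e : Matrix ι ι ℂ ≃ₗ[ℂ] (ι × ι → ℂ) := (LinearEquiv.curry ℂ ℂ ι ι).symm
      obtain ⟨W, hW, hWp⟩ := Matrix.exists_unitary_notMem
        (p := p.comap e.toLinearMap) (by
          intro h
          apply htop
          rw [eq_top_iff] at h ⊢
          intro x _
          simpa using h (x := e.symm x) trivial)
      exact ⟨W, hW, hWp⟩
    refine ⟨unitarySum U W, unitarySum_mem hU hW, ?_⟩
    have hlt := Submodule.finrank_lt htop
    rw [key, Submodule.finrank_sup_span_singleton hWp, hrank]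
    omega

end extension

/-! ### Ranks of block and arrow matrices -/

theorem Matrix.rank_fromBlocks_diagonal {ι κ K : Type*} [Field K] [DecidableEq K] [Fintype ι]
    [Fintype κ] [DecidableEq ι] [DecidableEq κ] (M : Matrix ι ι K) (d : κ → K) :
    (Matrix.fromBlocks M 0 0 (Matrix.diagonal d)).rank =
      M.rank + Fintype.card {k // d k ≠ 0} := by
  -- Transvections diagonalize `M` without touching the other block, which leaves a count of
  -- diagonal entries.
  obtain ⟨L, L', D, hM⟩ := Matrix.Pivot.exists_list_transvec_mul_diagonal_mul_list_transvec M
  set P := (L.map Matrix.TransvectionStruct.toMatrix).prod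
  set Q := (L'.map Matrix.TransvectionStruct.toMatrix).prod
  have hP : P.det = 1 := Matrix.TransvectionStruct.det_toMatrix_prod L
  have hQ : Q.det = 1 := Matrix.TransvectionStruct.det_toMatrix_prod L'
  have hfac : Matrix.fromBlocks M 0 0 (Matrix.diagonal d) =
      Matrix.fromBlocks P 0 0 1 * Matrix.diagonal (Sum.elim D d) * Matrix.fromBlocks Q 0 0 1 := by
    rw [← Matrix.fromBlocks_diagonal, Matrix.fromBlocks_multiply, Matrix.fromBlocks_multiply, hM]
    simp
  rw [hfac, Matrix.rank_mul_eq_left_of_isUnit_det _ _ (by simp [hQ]),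
    Matrix.rank_mul_eq_right_of_isUnit_det _ _ (by simp [hP]), hM,
    Matrix.rank_mul_eq_left_of_isUnit_det _ _ (by simp [hQ]),
    Matrix.rank_mul_eq_right_of_isUnit_det _ _ (by simp [hP]), Matrix.rank_diagonal,
    Matrix.rank_diagonal, Fintype.card_subtype, Fintype.card_subtype, Fintype.card_subtype,
    Finset.card_filter, Finset.card_filter, Finset.card_filter, Fintype.sum_sum_type]
  rfl

/-- The matrix with corner `1`, first row `a`, first column `b`, and identity lower block. -/
def arrowMatrix {κ : Type*} [DecidableEq κ] (a b : κ → ℂ) : Matrix (Unit ⊕ κ) (Unit ⊕ κ) ℂ :=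
  Matrix.fromBlocks 1 (Matrix.of fun _ k => a k) (Matrix.of fun k _ => b k) 1

/-- The Schur complement of the identity block is the scalar `1 - ∑ k, a k * b k`. -/
theorem rank_arrowMatrix {κ : Type*} [Fintype κ] [DecidableEq κ] (a b : κ → ℂ) :
    (arrowMatrix a b).rank = Fintype.card κ + if ∑ k, a k * b k = 1 then 0 else 1 := by
  let _ : Invertible (1 : Matrix κ κ ℂ) := invertibleOne
  have hdiag (d : Unit → ℂ) : Matrix.fromBlocks (Matrix.diagonal d) 0 0 (1 : Matrix κ κ ℂ) =
      Matrix.diagonal (Sum.elim d fun _ => 1) := by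
    rw [← Matrix.fromBlocks_diagonal, Matrix.diagonal_one]
  have hschur : (1 : Matrix Unit Unit ℂ) - Matrix.of (fun _ k => a k) * ⅟(1 : Matrix κ κ ℂ) *
      Matrix.of (fun k _ => b k) = Matrix.diagonal fun _ => 1 - ∑ k, a k * b k := by
    ext i j
    simp [Matrix.mul_apply]
  rw [arrowMatrix, Matrix.fromBlocks_eq_of_invertible₂₂, hschur, hdiag,
    Matrix.rank_mul_eq_left_of_isUnit_det _ _ (by simp),
    Matrix.rank_mul_eq_right_of_isUnit_det _ _ (by simp), Matrix.rank_diagonal,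
    Fintype.card_subtype, Finset.card_filter, Fintype.sum_sum_type]
  simp [sub_eq_zero, eq_comm (a := (1 : ℂ)), add_comm]

/-! ### Partial flips and their realignment -/

section flip

variable {ι : Type*} [Fintype ι] [DecidableEq ι]

/-- The operator `e i ⊗ e k ↦ M i k • e i ⊗ e k + N i k • e k ⊗ e i`. -/
def partialFlip (M N : Matrix ι ι ℂ) : Matrix (ι × ι) (ι × ι) ℂ :=
  Matrix.of fun x y => (if x = y then M y.1 y.2 else 0) + if x = y.swap then N y.1 y.2 else 0

/-- The span of `e i ⊗ e k` and `e k ⊗ e i` is invariant; the hypotheses say that the two columns of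
the operator there are normalized and orthogonal. -/
theorem partialFlip_mem {M N : Matrix ι ι ℂ}
    (h₁ : ∀ i k, star (M i k) * M i k + star (N i k) * N i k = 1)
    (h₂ : ∀ i k, star (M i k) * N k i + star (N i k) * M k i = 0) :
    partialFlip M N ∈ Matrix.unitaryGroup (ι × ι) ℂ := by
  rw [Matrix.mem_unitaryGroup_iff']
  ext ⟨i, k⟩ ⟨j, l⟩
  have hsum : (star (partialFlip M N) * partialFlip M N) (i, k) (j, l) =
      star (M i k) * partialFlip M N (i, k) (j, l) +
      star (N i k) * partialFlip M N (k, i) (j, l) := by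
    rw [Matrix.mul_apply]
    simp only [Matrix.star_apply, partialFlip, Matrix.of_apply, star_add, apply_ite star, star_zero,
      add_mul, ite_mul, zero_mul, Finset.sum_add_distrib, Finset.sum_ite_eq', Finset.mem_univ,
      if_true, Prod.swap_prod_mk]
  rw [hsum]
  simp only [partialFlip, Matrix.of_apply, Prod.swap_prod_mk, Prod.mk.injEq, Matrix.one_apply]
  by_cases hij : i = j ∧ k = l
  · obtain ⟨rfl, rfl⟩ := hij
    by_cases hik : i = k
    · subst hik
      simp only [and_self, if_true]
      -- Both terms land on `e i ⊗ e i`, with total amplitude `M i i + N i i`.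
      linear_combination h₁ i i + h₂ i i
    · simp only [and_self, if_true, hik, Ne.symm hik, if_false]
      linear_combination h₁ i k
  · by_cases hil : i = l ∧ k = j
    · obtain ⟨rfl, rfl⟩ := hil
      have hik : i ≠ k := fun h => hij ⟨h, h.symm⟩
      simp only [and_self, if_true, hik, Ne.symm hik, if_false]
      linear_combination h₂ i k
    · simp only [hij, hil, and_comm (a := k = _), if_false]
      simp

/-- Pairs of indices, split into the diagonal and its complement. -/
noncomputable def diagonalSum (ι : Type*) [DecidableEq ι] :
    ι ⊕ {p : ι × ι // p.1 ≠ p.2} ≃ ι × ι :=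
  Equiv.ofBijective (Sum.elim (fun i => (i, i)) Subtype.val) <| by
    constructor
    · rintro (i | ⟨⟨i, j⟩, h⟩) (k | ⟨⟨k, l⟩, h'⟩) <;> simp <;> grind
    · rintro ⟨i, j⟩
      by_cases h : i = j
      · exact ⟨Sum.inl i, by simp [h]⟩
      · exact ⟨Sum.inr ⟨(i, j), h⟩, rfl⟩

@[simp]
theorem diagonalSum_inl {ι : Type*} [DecidableEq ι] (i : ι) : diagonalSum ι (Sum.inl i) = (i, i) := rfl

@[simp]
theorem diagonalSum_inr {ι : Type*} [DecidableEq ι] (p : {p : ι × ι // p.1 ≠ p.2}) : diagonalSum ι (Sum.inr p) = p.1 := rfl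

/-- Realignment puts `M i k` at row `(i, i)`, column `(k, k)`, and `N j i` at row `(i, j)`, column
`(j, i)`. So `M` is one block, and the off-diagonal entries of `N` form a diagonal block once
columns are swapped. -/
theorem rank_realignment_partialFlip (M N : Matrix ι ι ℂ) (hN : ∀ i, N i i = 0) :
    (realignment (partialFlip M N)).rank =
      M.rank + ∑ i, ∑ k, if N i k ≠ 0 then 1 else 0 := by
  have hblocks : (realignment (partialFlip M N)).submatrix (diagonalSum ι)
      ((diagonalSum ι).trans (Equiv.prodComm ι ι)) =
      Matrix.fromBlocks M 0 0
        (Matrix.diagonal fun p : {p : ι × ι // p.1 ≠ p.2} => N p.1.2 p.1.1) := by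
    ext (i | ⟨⟨i, j⟩, h⟩) (k | ⟨⟨k, l⟩, h'⟩)
    · by_cases hik : i = k
      · subst hik
        simp [realignment, partialFlip, hN]
      · simp [realignment, partialFlip, hik]
    · simp [realignment, partialFlip]
      grind
    · simp [realignment, partialFlip]
      grind
    · simp [realignment, partialFlip, Matrix.diagonal_apply]
      grind
  rw [← Matrix.rank_submatrix _ (diagonalSum ι) ((diagonalSum ι).trans (Equiv.prodComm ι ι)),
    hblocks, Matrix.rank_fromBlocks_diagonal, Fintype.card_subtype, Finset.card_filter]
  congr 1
  rw [Finset.sum_comm, ← Fintype.sum_prod_type' (fun k i => if N i k ≠ 0 then 1 else 0),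
    ← (diagonalSum ι).sum_comp, Fintype.sum_sum_type]
  simp only [diagonalSum_inl, diagonalSum_inr, hN, ne_eq, not_true_eq_false, if_false,
    Finset.sum_const_zero, zero_add]
  exact Finset.sum_congr rfl fun p _ => if_congr Iff.rfl rfl rfl

end flip

/-! ### Arrow-shaped amplitudes and the ranks from `k ^ 2` to `(k + 1) ^ 2` -/

/-- The flip amplitudes that go with `arrowMatrix`. -/
def arrowFlip {κ : Type*} [DecidableEq κ] (s : κ → ℂ) : Matrix (Unit ⊕ κ) (Unit ⊕ κ) ℂ :=
  Matrix.fromBlocks 0 (Matrix.of fun _ k => s k) (Matrix.of fun k _ => s k)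
    (Matrix.of fun k l => if k = l then 0 else 1)

/-- Full flips within `κ` and the identity block of the arrow together give the square; a flipped
pair through the corner counts twice; the last term is the Schur complement. -/
theorem isUnitarySchmidtRank_arrow {κ : Type*} [Fintype κ] [DecidableEq κ] (a b s : κ → ℂ)
    (ha : ∀ k, star (a k) * a k + star (s k) * s k = 1)
    (hb : ∀ k, star (b k) * b k + star (s k) * s k = 1)
    (hab : ∀ k, star (a k) * s k + star (s k) * b k = 0) :
    IsUnitarySchmidtRank (Unit ⊕ κ) (Unit ⊕ κ) (Fintype.card κ ^ 2 +
      2 * (∑ k, if s k ≠ 0 then 1 else 0) + if ∑ k, a k * b k = 1 then 0 else 1) := by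
  refine ⟨partialFlip (arrowMatrix a b) (arrowFlip s), partialFlip_mem ?_ ?_, ?_⟩
  · rintro (i | i) (k | k)
    · simp [arrowMatrix, arrowFlip]
    · exact ha k
    · exact hb i
    · by_cases h : i = k <;> simp [arrowMatrix, arrowFlip, h]
  · rintro (i | i) (k | k)
    · simp [arrowMatrix, arrowFlip]
    · exact hab k
    · have := congrArg star (hab i)
      simp only [star_add, star_mul', star_star, star_zero] at this
      change star (b i) * s i + star (s i) * a i = 0
      linear_combination this
    · by_cases h : i = k
      · simp [arrowFlip, h]
      · simp [arrowMatrix, h, Ne.symm h]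
  · rw [rank_realignment_partialFlip _ _ (by rintro (i | i) <;> simp [arrowFlip]), rank_arrowMatrix]
    -- The added `1`, from the identity block of the arrow, fills in the missing diagonal flip.
    have hrow : ∀ i : κ, 1 + ∑ k : κ, (if arrowFlip s (Sum.inr i) (Sum.inr k) ≠ 0 then 1 else 0) =
        Fintype.card κ := by
      intro i
      have h1 : (1 : ℕ) = ∑ k : κ, if i = k then 1 else 0 := by simp
      rw [h1, ← Finset.sum_add_distrib, Fintype.card_eq_sum_ones]
      refine Finset.sum_congr rfl fun k _ => ?_
      by_cases h : i = k <;> simp [h, arrowFlip]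
    have hoff : Fintype.card κ + ∑ i : κ, ∑ k : κ,
        (if arrowFlip s (Sum.inr i) (Sum.inr k) ≠ 0 then 1 else 0) = Fintype.card κ ^ 2 := by
      rw [Fintype.card_eq_sum_ones, ← Finset.sum_add_distrib, ← Fintype.card_eq_sum_ones,
        Finset.sum_congr rfl fun i _ => hrow i]
      simp [sq]
    have hcorner : (if arrowFlip s (Sum.inl ()) (Sum.inl ()) ≠ 0 then 1 else 0) = 0 := by
      simp [arrowFlip]
    have hleft : ∀ k, (if arrowFlip s (Sum.inl ()) (Sum.inr k) ≠ 0 then 1 else 0) =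
        if s k ≠ 0 then 1 else 0 := fun _ => rfl
    have hright : ∀ k, (if arrowFlip s (Sum.inr k) (Sum.inl ()) ≠ 0 then 1 else 0) =
        if s k ≠ 0 then 1 else 0 := fun _ => rfl
    simp only [Fintype.sum_sum_type, Finset.sum_add_distrib, Finset.univ_unique,
      Finset.sum_singleton, PUnit.default_eq_unit, hcorner, hleft, hright]
    rw [← hoff]
    ring

/-- Such amplitudes make the Schur complement vanish. At least one term is needed, as the empty sum
is zero. -/
theorem exists_unimodular_sum_eq_one (j : ℕ) :
    ∃ p : Fin (j + 1) → ℂ, (∀ k, star (p k) * p k = 1) ∧ ∑ k, p k = 1 := by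
  induction j using Nat.twoStepInduction with
  | zero => exact ⟨fun _ => 1, by simp, by simp⟩
  | one =>
    have h3 : (Real.sqrt 3) ^ 2 = 3 := Real.sq_sqrt (by norm_num)
    -- The two primitive sixth roots of unity.
    refine ⟨![⟨1 / 2, Real.sqrt 3 / 2⟩, ⟨1 / 2, -(Real.sqrt 3 / 2)⟩], ?_, ?_⟩
    · intro k
      fin_cases k <;> apply Complex.ext <;> simp <;> nlinarith
    · rw [Fin.sum_univ_two]
      apply Complex.ext <;> simp; norm_num
  | more j ih _ =>
    obtain ⟨p, hp, hsum⟩ := ih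
    refine ⟨Fin.cons 1 (Fin.cons (-1) p), ?_, ?_⟩
    · intro k
      refine Fin.cases (by simp) (fun k => ?_) k
      refine Fin.cases (by simp) (fun k => ?_) k
      simpa using hp k
    · simp [Fin.sum_univ_succ (n := j + 2), Fin.sum_univ_succ (n := j + 1), hsum]

/-- With `j` unflipped and `e` flipped pairs through the corner, and unimodular `p`. -/
theorem isUnitarySchmidtRank_of_unimodular {k j e : ℕ} (hk : j + e = k) (p : Fin j → ℂ)
    (hp : ∀ i, star (p i) * p i = 1) :
    IsUnitarySchmidtRank (Fin (k + 1)) (Fin (k + 1))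
      (k ^ 2 + 2 * e + if ∑ i, p i = 1 then 0 else 1) := by
  have h := isUnitarySchmidtRank_arrow (κ := Fin j ⊕ Fin e) (Sum.elim 1 0) (Sum.elim p 0)
    (Sum.elim 0 1) (by rintro (i | i) <;> simp) (by rintro (i | i) <;> simp; simpa using hp i)
    (by rintro (i | i) <;> simp)
  have E : Fin (k + 1) ≃ Unit ⊕ (Fin j ⊕ Fin e) :=
    Fintype.equivOfCardEq (by simp; omega)
  simpa [Fintype.sum_sum_type, hk] using h.congr E E

/-- All pairs flipped, some partially, with a singular matrix of unflipped amplitudes. -/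
theorem isUnitarySchmidtRank_sq_sub_one (k : ℕ) :
    IsUnitarySchmidtRank (Fin (k + 2 + 1)) (Fin (k + 2 + 1)) ((k + 2) ^ 2 + 2 * (k + 2)) := by
  have hI : Complex.I * Complex.I = -1 := Complex.I_mul_I
  -- The triple 3, 4, 5 gives `∑ i, a i * a i = 1` with every `s i` nonzero; imaginary flip
  -- amplitudes cancel the cross terms. Two pairs are needed: for a single one, `a * a = 1` would
  -- force `s = 0`.
  let a : Fin (k + 2) → ℂ := Fin.cons (3 / 5) (Fin.cons (4 / 5) 0)
  let s : Fin (k + 2) → ℂ :=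
    Fin.cons (4 / 5 * Complex.I) (Fin.cons (3 / 5 * Complex.I) 1)
  have ha : ∀ i, star (a i) * a i + star (s i) * s i = 1 := by
    intro i
    refine Fin.cases ?_ (fun i => Fin.cases ?_ (fun i => ?_) i) i
    · simp [a, s]
      linear_combination (-16 / 25) * hI
    · simp [a, s]
      linear_combination (-9 / 25) * hI
    · simp [a, s]
  have hab : ∀ i, star (a i) * s i + star (s i) * a i = 0 := by
    intro i
    refine Fin.cases ?_ (fun i => Fin.cases ?_ (fun i => ?_) i) i
    · simp [a, s]
      ring
    · simp [a, s]
      ring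
    · simp [a, s]
  have hs : ∀ i, s i ≠ 0 := by
    intro i
    refine Fin.cases ?_ (fun i => Fin.cases ?_ (fun i => ?_) i) i <;> simp [s]
  have hsum : ∑ i, a i * a i = 1 := by
    rw [Fin.sum_univ_succ, Fin.sum_univ_succ]
    simp [a]
    norm_num
  have E : Fin (k + 2 + 1) ≃ Unit ⊕ Fin (k + 2) :=
    Fintype.equivOfCardEq (by simp; omega)
  simpa [hs, hsum] using (isUnitarySchmidtRank_arrow a a s ha ha hab).congr E E

theorem isUnitarySchmidtRank_of_sq_add {k e d : ℕ} (he : e ≤ k) (hd : d ≤ 1)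
    (h : d = 1 ∨ e < k ∨ 2 ≤ k) :
    IsUnitarySchmidtRank (Fin (k + 1)) (Fin (k + 1)) (k ^ 2 + 2 * e + d) := by
  obtain rfl | rfl : d = 1 ∨ d = 0 := by omega
  -- Amplitudes `-1` have a nonpositive sum, even when no pair is left unflipped.
  · have hne : ∑ _i : Fin (k - e), (-1 : ℂ) ≠ 1 := by
      intro h
      have := congrArg Complex.re h
      simp at this
      have : (0 : ℝ) ≤ ((k - e : ℕ) : ℝ) := Nat.cast_nonneg _
      linarith
    simpa only [hne, if_false] using
      isUnitarySchmidtRank_of_unimodular (Nat.sub_add_cancel he) (fun _ => -1) (by simp)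
  · by_cases hek : e < k
    · obtain ⟨p, hp, hsum⟩ := exists_unimodular_sum_eq_one (k - e - 1)
      simpa only [hsum, if_true] using
        isUnitarySchmidtRank_of_unimodular (k := k) (e := e) (by omega) p hp
    -- All pairs are flipped, so vanishing of the Schur complement calls for partial flips.
    · obtain ⟨k, rfl⟩ : ∃ l, k = l + 2 := ⟨k - 2, by omega⟩
      obtain rfl : e = k + 2 := by omega
      exact isUnitarySchmidtRank_sq_sub_one k

/-! ### Induction on the dimensions -/

theorem IsUnitarySchmidtRank.succ {n m r : ℕ} (h : IsUnitarySchmidtRank (Fin n) (Fin m) r) :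
    IsUnitarySchmidtRank (Fin n) (Fin (m + 1)) (min (r + 1) (n ^ 2)) := by
  have E : Fin (m + 1) ≃ Fin m ⊕ Unit := Fintype.equivOfCardEq (by simp)
  simpa using h.extend.congr (Equiv.refl _) E

/-- The rank `n ^ 2 - 1` is not needed for the smaller space. -/
theorem isUnitarySchmidtRank_fin_succ {n m : ℕ}
    (h : ∀ r, 1 ≤ r → r ≤ n ^ 2 → r + 1 ≠ n ^ 2 → IsUnitarySchmidtRank (Fin n) (Fin m) r)
    {r : ℕ} (hr : 1 ≤ r) (hrn : r ≤ n ^ 2) : IsUnitarySchmidtRank (Fin n) (Fin (m + 1)) r := by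
  rcases hr.eq_or_lt with rfl | hr'
  · have : NeZero n := ⟨by rintro rfl; simp at hrn⟩
    exact isUnitarySchmidtRank_one
  -- Rank `n ^ 2` comes from itself through the cap, any smaller `r` from `r - 1 ≤ n ^ 2 - 2`.
  · rcases hrn.eq_or_lt with rfl | hrn'
    · simpa using (h _ hr le_rfl (by omega)).succ
    · have := (h (r - 1) (by omega) (by omega) (by omega)).succ
      rwa [Nat.sub_add_cancel hr, min_eq_left hrn] at this

theorem isUnitarySchmidtRank_square (n : ℕ) :
    ∀ r, 1 ≤ r → r ≤ n ^ 2 → (n = 2 → r ≠ 3) → IsUnitarySchmidtRank (Fin n) (Fin n) r := by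
  induction n with
  | zero => intro r h1 h2; simp at h2; omega
  | succ k ih =>
    intro r hr hrn h3
    have hsq : (k + 1) ^ 2 = k ^ 2 + 2 * k + 1 := by ring
    rcases hr.eq_or_lt with rfl | hr'
    · exact isUnitarySchmidtRank_one
    · by_cases hrk : r ≤ k ^ 2 + 1
      -- Each factor is enlarged in turn; the second enlargement, of a factor next to one of
      -- dimension `k + 1`, can reach `k ^ 2 + 1`.
      · have h := (isUnitarySchmidtRank_fin_succ (m := k) (r := r - 1)
          (fun s hs hsk hne => ih s hs hsk (by rintro rfl; omega)) (by omega) (by omega)).swap.succ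
        rwa [Nat.sub_add_cancel hr, min_eq_left hrn] at h
      · have h := isUnitarySchmidtRank_of_sq_add (k := k) (e := (r - k ^ 2) / 2)
          (d := (r - k ^ 2) % 2) (by omega) (by omega) (by
            -- Only `k ≤ 1` is left: `k = 0` contradicts `1 < r`, and `k = 1` gives the excluded
            -- rank 3.
            by_contra! hc
            obtain ⟨h1, h2, h4⟩ := hc
            interval_cases k <;> omega)
        rwa [show k ^ 2 + 2 * ((r - k ^ 2) / 2) + (r - k ^ 2) % 2 = r by omega] at h

theorem isUnitarySchmidtRank_of_lt {n m : ℕ} (hnm : n < m) {r : ℕ} (hr : 1 ≤ r)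
    (hrn : r ≤ n ^ 2) : IsUnitarySchmidtRank (Fin n) (Fin m) r := by
  induction m, hnm using Nat.le_induction generalizing r with
  | base =>
    exact isUnitarySchmidtRank_fin_succ
      (fun s hs hsn hne => isUnitarySchmidtRank_square n s hs hsn (by rintro rfl; omega)) hr hrn
  | succ m _ ih => exact isUnitarySchmidtRank_fin_succ (fun s hs hsn _ => ih hs hsn) hr hrn

theorem theorem1p3 (n m : ℕ) (hnm : (n, m) ≠ (2, 2))
    (r : ℕ) (hr : r ∈ Finset.Icc 1 (min n m ^ 2)) :
    ∃ U ∈ Matrix.unitaryGroup (Fin n × Fin m) ℂ, operatorSchmidtRank U = r := by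
  simp only [operatorSchmidtRank_eq_rank_realignment]
  change IsUnitarySchmidtRank (Fin n) (Fin m) r
  rw [Finset.mem_Icc] at hr
  obtain ⟨hr1, hr2⟩ := hr
  rcases lt_trichotomy n m with h | rfl | h
  · rw [min_eq_left h.le] at hr2
    exact isUnitarySchmidtRank_of_lt h hr1 hr2
  · rw [min_self] at hr2
    exact isUnitarySchmidtRank_square n r hr1 hr2 (by rintro rfl; exact absurd rfl hnm)
  · rw [min_eq_right h.le] at hr2
    exact (isUnitarySchmidtRank_of_lt h hr1 hr2).swap
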